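/- Let $M$ be a smooth $n$-dimensional manifold (without boundary) with a fixed complete smooth Riemannian metric $g_{\mathrm R}$, let $k\ge 2$ be an integer and $\nu\in\{0,\dots,n\}$. Let $\mathcal E$ be a $C^k$-Whitney type Banach space of tensor fields over $M$, i.e. a vector space of $C^k$ symmetric $(0,2)$-tensor fields on $M$ that contains all compactly supported ones and carries a Banach norm whose convergence of sequences implies convergence in the weak Whitney $C^k$-topology ($C^k$-convergence on compact sets). Let $\mathcal A_\nu$ be an open subset of the set of all semi-Riemannian metrics of index $\nu$ that belong to $\mathcal E$. For a metric $g$ on $M$ let $\overline g=g\oplus(-g)$ on $M\times M$; for a submanifold $\mathcal P\subset M\times M$ let $\mathcal A_{\nu,\mathcal P}$ be the set of $g\in\mathcal A_\nu$ such that the restriction of $\overline g$ to $T_x\mathcal P$ is nondegenerate for every $x\in\mathcal P$, with the topology induced by $\mathcal E$. A $\nu$-general boundary condition is a compact (embedded, smooth, boundaryless) submanifold $\mathcal P\subset M\times M$ with $\mathcal A_{\nu,\mathcal P}\neq\varnothing$. For $g\in\mathcal A_{\nu,\mathcal P}$, a $(g,\mathcal P)$-geodesic is an affinely parametrized $g$-geodesic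 $\gamma:[0,1]\to M$ with $(\gamma(0),\gamma(1))\in\mathcal P$ and $(\dot\gamma(0),\dot\gamma(1))$ $\overline g$-orthogonal to $T_{(\gamma(0),\gamma(1))}\mathcal P$. **Proposition 4.3.** Let $\mathcal P$ be a $\nu$-general boundary condition that meets the diagonal $\Delta\subset M\times M$ transversally, that is, for every $x\in M$ with $(x,x)\in\mathcal P$, $T_{(x,x)}\mathcal P+\{(v,v):v\in T_xM\}=T_xM\oplus T_xM$. Then $\mathcal P$ is admissible: for every $g_0\in\mathcal A_{\nu,\mathcal P}$ there are an open neighborhood $\mathcal V$ of $g_0$ in $\mathcal A_{\nu,\mathcal P}$ and a number $a>0$ such that every nonconstant $(g,\mathcal P)$-geodesic $\gamma$ with $g\in\mathcal V$ has $g_{\mathrm R}$-length $\int_0^1\|\dot\gamma(t)\|_{\mathrm R}\,dt\ge a$. -/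

import Mathlib

open Set Filter Topology
open scoped Manifold ContDiff Bundle

namespace GeneralBoundary

noncomputable section

/-- `E n` is Euclidean space `ℝⁿ`, the model of an `n`-dimensional manifold. -/
abbrev E (n : ℕ) : Type := EuclideanSpace ℝ (Fin n)

section Tensors

variable (n : ℕ) (M : Type*) [TopologicalSpace M] [ChartedSpace (E n) M]

/-- Arbitrary (not necessarily regular or symmetric) sections of `TM* ⊗ TM*`. -/
abbrev BilinField : Type _ :=
  ∀ x : M, TangentSpace (𝓡 n) x →L[ℝ] TangentSpace (𝓡 n) x →L[ℝ] ℝ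

/-! Shortcuts for instance search (nothing new is defined). -/

instance (x : M) : IsTopologicalAddGroup (TangentSpace (𝓡 n) x →L[ℝ] ℝ) :=
  ContinuousLinearMap.topologicalAddGroup

instance (x : M) : ContinuousAdd (TangentSpace (𝓡 n) x →L[ℝ] ℝ) :=
  IsTopologicalAddGroup.toContinuousAdd

instance (x : M) : ContinuousConstSMul ℝ (TangentSpace (𝓡 n) x →L[ℝ] ℝ) :=
  ContinuousLinearMap.continuousConstSMul

instance (x : M) : AddCommGroup (TangentSpace (𝓡 n) x →L[ℝ] TangentSpace (𝓡 n) x →L[ℝ] ℝ) :=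
  ContinuousLinearMap.addCommGroup

instance (x : M) : AddCommMonoid (TangentSpace (𝓡 n) x →L[ℝ] TangentSpace (𝓡 n) x →L[ℝ] ℝ) :=
  ContinuousLinearMap.addCommMonoid

instance (x : M) : Module ℝ (TangentSpace (𝓡 n) x →L[ℝ] TangentSpace (𝓡 n) x →L[ℝ] ℝ) :=
  ContinuousLinearMap.module

/-- The vector space `Γ^k_sym(TM* ⊗ TM*)` of `C^k` symmetric `(0,2)`-tensor fields on `M`. -/
def SymTensor [IsManifold (𝓡 n) ∞ M] (k : ℕ) : Submodule ℝ (BilinField n M) where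
  carrier := {b | ContMDiff (𝓡 n) ((𝓡 n).prod 𝓘(ℝ, E n →L[ℝ] E n →L[ℝ] ℝ)) k
      (fun x ↦ Bundle.TotalSpace.mk' (E n →L[ℝ] E n →L[ℝ] ℝ) x (b x)) ∧
    ∀ x v w, b x v w = b x w v}
  add_mem' {b c} hb hc := ⟨hb.1.add_section hc.1, fun x v w ↦ by
    simp [hb.2 x v w, hc.2 x v w]⟩
  zero_mem' := ⟨Bundle.contMDiff_zeroSection ℝ _, fun x v w ↦ rfl⟩
  smul_mem' r b hb := ⟨hb.1.const_smul_section, fun x v w ↦ by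
    simp [hb.2 x v w]⟩

variable {n M}

/-- The expression of a `(0,2)`-tensor field in the chart centred at `x₀`: the pull-back of `b` by
the inverse of the chart.  It is meaningful on `(extChartAt (𝓡 n) x₀).target`. -/
def localRep (b : BilinField n M) (x₀ : M) (y : E n) : E n →L[ℝ] E n →L[ℝ] ℝ :=
  let A : E n →L[ℝ] E n := mfderiv 𝓘(ℝ, E n) (𝓡 n) (extChartAt (𝓡 n) x₀).symm y
  let B : E n →L[ℝ] E n →L[ℝ] ℝ := b ((extChartAt (𝓡 n) x₀).symm y)
  B.bilinearComp A A

theorem localRep_apply (b : BilinField n M) (x₀ : M) (y v w : E n) :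
    localRep b x₀ y v w = b ((extChartAt (𝓡 n) x₀).symm y)
      (mfderiv 𝓘(ℝ, E n) (𝓡 n) (extChartAt (𝓡 n) x₀).symm y v)
      (mfderiv 𝓘(ℝ, E n) (𝓡 n) (extChartAt (𝓡 n) x₀).symm y w) :=
  rfl

/-- Convergence of a sequence of `(0,2)`-tensor fields in the weak Whitney `C^k`-topology: in every
chart of the atlas, all derivatives of order `≤ k` of the local expressions converge uniformly on
compact sets. -/
def WhitneyTendsto (k : ℕ) (u : ℕ → BilinField n M) (b : BilinField n M) : Prop :=
  ∀ x₀ : M, ∀ K : Set (E n), IsCompact K → K ⊆ (extChartAt (𝓡 n) x₀).target → ∀ i ≤ k,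
    ∀ ε : ℝ, 0 < ε → ∀ᶠ α in atTop, ∀ y ∈ K,
      ‖iteratedFDeriv ℝ i (localRep (u α) x₀) y - iteratedFDeriv ℝ i (localRep b x₀) y‖ < ε

/-- The quadratic form `v ↦ b(v, v)` of `b` at the point `x`. -/
def quadForm (b : BilinField n M) (x : M) : QuadraticForm ℝ (TangentSpace (𝓡 n) x) :=
  LinearMap.BilinMap.toQuadraticMap
    (LinearMap.mk₂ ℝ (fun v w : TangentSpace (𝓡 n) x ↦ b x v w)
      (by simp) (by simp) (by simp) (by simp))

/-- A symmetric `(0,2)`-tensor field is a semi-Riemannian metric of index `ν` if at each point it is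
nondegenerate and the maximal dimension of a negative definite subspace is `ν`. -/
def IsMetric (ν : ℕ) (b : BilinField n M) : Prop :=
  ∀ x : M, (∀ v, (∀ w, b x v w = 0) → v = 0) ∧ sigNeg (quadForm b x) = ν

end Tensors

/-- A realization of the Banach space `V` as a `C^k`-Whitney type Banach space of tensor fields
over `M`: a linear identification of `V` with a subspace of `Γ^k_sym(TM* ⊗ TM*)` containing all
compactly supported fields, such that convergence in norm implies convergence in the weak
Whitney `C^k`-topology. -/
structure WhitneyBanach (n : ℕ) (M : Type*) [TopologicalSpace M] [ChartedSpace (E n) M]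
    [IsManifold (𝓡 n) ∞ M] (k : ℕ) (V : Type*) [NormedAddCommGroup V] [NormedSpace ℝ V]
    [CompleteSpace V] where
  toField : V →ₗ[ℝ] SymTensor n M k
  injective : Function.Injective toField
  exists_of_compactSupport : ∀ b : SymTensor n M k,
    (∃ K : Set M, IsCompact K ∧ ∀ x ∉ K, b.1 x = 0) → ∃ g : V, toField g = b
  whitneyTendsto : ∀ (u : ℕ → V) (g : V), Tendsto u atTop (𝓝 g) →
    WhitneyTendsto k (fun α ↦ (toField (u α)).1) (toField g).1

section Submanifolds

variable {n : ℕ} {M : Type*} [TopologicalSpace M] [ChartedSpace (E n) M]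

/-- `P ⊆ M × M` is an embedded smooth submanifold (without boundary): around each of its points
there is a smooth chart of `M × M` in which `P` is a linear subspace. -/
def IsSubmanifold (P : Set (M × M)) : Prop :=
  ∀ x ∈ P, ∃ φ ∈ IsManifold.maximalAtlas ((𝓡 n).prod (𝓡 n)) ∞ (M × M), x ∈ φ.source ∧
    ∃ W : Submodule ℝ (E n × E n), ∀ y ∈ φ.source, y ∈ P ↔ φ y ∈ (W : Set (E n × E n))

variable (n) in
/-- `T_pM ⊕ T_qM`, that is, the tangent space of `M × M` at `x = (p, q)`. -/
abbrev TProd (x : M × M) : Type := TangentSpace (𝓡 n) x.1 × TangentSpace (𝓡 n) x.2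

/-- The tangent space `T_x P`: the span of the velocities at `0` of the smooth curves in `P` that
pass through `x` at time `0`.  (For a submanifold these velocities already form a subspace.) -/
def tangentTo (P : Set (M × M)) (x : M × M) : Submodule ℝ (TProd n x) :=
  Submodule.span ℝ {v | ∃ σ : ℝ → M × M, σ 0 = x ∧ (∀ᶠ t in 𝓝 0, σ t ∈ P) ∧
    ContMDiffAt 𝓘(ℝ, ℝ) ((𝓡 n).prod (𝓡 n)) ∞ σ 0 ∧
    v.1 = mfderiv 𝓘(ℝ, ℝ) (𝓡 n) (fun t ↦ (σ t).1) 0 (1 : ℝ) ∧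
    v.2 = mfderiv 𝓘(ℝ, ℝ) (𝓡 n) (fun t ↦ (σ t).2) 0 (1 : ℝ)}

variable (n) in
/-- The diagonal of `T_pM ⊕ T_pM`, that is, the tangent space at `(p, p)` of the diagonal of
`M × M`. -/
def tangentDiag (p : M) : Submodule ℝ (TProd n (p, p)) :=
  LinearMap.range (LinearMap.prod (LinearMap.id : TangentSpace (𝓡 n) p →ₗ[ℝ] _) LinearMap.id)

variable (n) in
/-- `P` meets the diagonal of `M × M` transversally. -/
def TransverseToDiagonal (P : Set (M × M)) : Prop :=
  ∀ p : M, (p, p) ∈ P → tangentTo (n := n) P (p, p) ⊔ tangentDiag n p = ⊤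

/-- The bilinear form `g ⊕ (-g)` on `M × M`. -/
def prodForm (g : BilinField n M) (x : M × M) (v w : TProd n x) : ℝ :=
  g x.1 v.1 w.1 - g x.2 v.2 w.2

/-- `P` is nondegenerate for `g ⊕ (-g)`: the restriction of this form to each tangent space of `P`
is nondegenerate. -/
def NondegenerateOn (g : BilinField n M) (P : Set (M × M)) : Prop :=
  ∀ x ∈ P, ∀ v ∈ tangentTo P x, (∀ w ∈ tangentTo P x, prodForm g x v w = 0) → v = 0

end Submanifolds

section Geodesics

variable {n : ℕ} {M : Type*} [TopologicalSpace M] [ChartedSpace (E n) M]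

/-- Christoffel symbols of the first kind (Koszul formula) in the chart centred at `x₀`:
`g(∇_u v, w)` for the constant coordinate fields `u, v, w`. -/
def christoffel (g : BilinField n M) (x₀ : M) (y u v w : E n) : ℝ :=
  (fderiv ℝ (localRep g x₀) y u v w + fderiv ℝ (localRep g x₀) y v u w
    - fderiv ℝ (localRep g x₀) y w u v) / 2

/-- The restriction of `γ` to `[0,1]` is a `C²` solution of the geodesic equation
`D^g γ' / dt = 0` (so it is affinely parametrized).  In each chart, `c` denotes the curve in
coordinates, and the equation `c'' + Γ(c', c') = 0` is written with its index lowered by `g`. -/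
def IsGeodesic (g : BilinField n M) (γ : ℝ → M) : Prop :=
  ContMDiffOn 𝓘(ℝ, ℝ) (𝓡 n) 2 γ (Icc 0 1) ∧
  ∀ x₀ : M, ∀ t ∈ Icc (0 : ℝ) 1, γ t ∈ (extChartAt (𝓡 n) x₀).source →
    let c : ℝ → E n := fun s ↦ extChartAt (𝓡 n) x₀ (γ s)
    let c' : ℝ → E n := derivWithin c (Icc 0 1)
    ∀ w : E n, localRep g x₀ (c t) (derivWithin c' (Icc 0 1) t) w
      + christoffel g x₀ (c t) (c' t) (c' t) w = 0

/-- The velocity `γ'(t) ∈ T_{γ(t)}M` of a curve defined on `[0,1]` (one-sided at the ends). -/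
def velocity (γ : ℝ → M) (t : ℝ) : TangentSpace (𝓡 n) (γ t) :=
  mfderivWithin 𝓘(ℝ, ℝ) (𝓡 n) γ (Icc 0 1) t (1 : ℝ)

/-- `(g, P)`-geodesics: `g`-geodesics `γ` on `[0,1]` with `(γ(0), γ(1)) ∈ P` and
`(γ'(0), γ'(1))` orthogonal to `P` with respect to `g ⊕ (-g)`. -/
def IsBoundaryGeodesic (g : BilinField n M) (P : Set (M × M)) (γ : ℝ → M) : Prop :=
  IsGeodesic g γ ∧ (γ 0, γ 1) ∈ P ∧
    ∀ w ∈ tangentTo (n := n) P (γ 0, γ 1),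
      prodForm g (γ 0, γ 1) (velocity γ 0, velocity γ 1) w = 0

end Geodesics

section BoundaryConditions

variable {n : ℕ} {M : Type*} [TopologicalSpace M] [ChartedSpace (E n) M] [IsManifold (𝓡 n) ∞ M]
  {k : ℕ} {V : Type*} [NormedAddCommGroup V] [NormedSpace ℝ V] [CompleteSpace V]

/-- `A` is a relatively open subset of the set `𝓔 ∩ Met^k_ν(M)` of all metrics of index `ν` that
belong to the Whitney type Banach space `𝓔`. -/
def IsOpenInMetrics (𝓔 : WhitneyBanach n M k V) (ν : ℕ) (A : Set V) : Prop :=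
  ∃ U : Set V, IsOpen U ∧ A = U ∩ {g | IsMetric ν (𝓔.toField g).1}

/-- The set `A_{ν,P}` of the metrics `g ∈ A` such that `P` is nondegenerate for `g ⊕ (-g)`. -/
def nondegenerateMetrics (𝓔 : WhitneyBanach n M k V) (A : Set V) (P : Set (M × M)) : Set V :=
  {g ∈ A | NondegenerateOn (𝓔.toField g).1 P}

/-- General boundary conditions. -/
structure IsGeneralBoundaryCondition (𝓔 : WhitneyBanach n M k V) (A : Set V)
    (P : Set (M × M)) : Prop where
  isCompact : IsCompact P
  isSubmanifold : IsSubmanifold (n := n) P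
  nonempty : (nondegenerateMetrics 𝓔 A P).Nonempty

/-- Admissibility of a boundary condition `P`: each `g₀ ∈ A_{ν,P}` has an open neighbourhood `U` in
`A_{ν,P}` for which there is `a > 0` such that every nonconstant `(g, P)`-geodesic with `g ∈ U` has
length at least `a`.  Length is that of the Riemannian metric on `M`. -/
def IsAdmissible [Bundle.RiemannianBundle (fun x : M ↦ TangentSpace (𝓡 n) x)]
    (𝓔 : WhitneyBanach n M k V) (A : Set V) (P : Set (M × M)) : Prop :=
  ∀ g₀ : nondegenerateMetrics 𝓔 A P, ∃ U : Set (nondegenerateMetrics 𝓔 A P),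
    IsOpen U ∧ g₀ ∈ U ∧ ∃ a : ℝ, 0 < a ∧ ∀ g ∈ U, ∀ γ : ℝ → M,
      IsBoundaryGeodesic (𝓔.toField g).1 P γ →
      (∃ t ∈ Icc (0 : ℝ) 1, γ t ≠ γ 0) →
      ENNReal.ofReal a ≤ Manifold.pathELength (𝓡 n) γ 0 1

end BoundaryConditions

end

end GeneralBoundary

/-!
Suppose that the lengths of nonconstant `(gᵢ, P)`-geodesics `γᵢ` tend to `0` while `gᵢ → g₀`. By
compactness of `P`, their endpoints converge to some `(p, q) ∈ P`, and `p = q` since the Riemannian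
distance of the endpoints tends to `0`. So `γᵢ` eventually lies in a chart around `p`. There the
metrics `gᵢ` converge in `C¹` to the nondegenerate `g₀`, hence the geodesic equation gives a bound
`‖c''‖ ≤ C ‖c'‖²` with a common constant `C` (`IsGeodesic.norm_acceleration_le`). Integrating it,
the velocity of `γᵢ` divided by its maximal norm varies along `γᵢ` by at most `C` times the length
(`norm_derivWithin_sub_le`). Consequently the normalized velocities at both endpoints converge to one
and the same unit vector `v`.

Tangent vectors of `P` at `(p, p)` are limits of tangent vectors of `P` at the endpoints
(`exists_tangentTo_tendsto`), so in the limit `(v, v)` is orthogonal to `P` for `g₀ ⊕ (-g₀)`. It is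
also orthogonal to the diagonal, since `g₀(v, w) - g₀(v, w) = 0`. By transversality it is orthogonal
to everything (`TransverseToDiagonal.eq_zero`), which forces `v = 0`, a contradiction.
-/

namespace GeneralBoundary

/-! ### Curves with quadratically bounded acceleration -/

section Calculus

variable {F : Type*} [NormedAddCommGroup F] [NormedSpace ℝ F] [CompleteSpace F]

/-- If the acceleration of `c` is bounded by `C` times the square of its speed, then the velocity
varies by at most `C` times the maximal speed times the length: integrate
`‖c''‖ ≤ C ‖c'‖ ‖c'‖ ≤ C m ‖c'‖`. -/
theorem norm_derivWithin_sub_le {c : ℝ → F} (hc : ContDiffOn ℝ 2 c (Icc 0 1)) {C m : ℝ}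
    (hC : 0 ≤ C)
    (hm : ∀ t ∈ Icc (0 : ℝ) 1, ‖derivWithin c (Icc 0 1) t‖ ≤ m)
    (h : ∀ t ∈ Icc (0 : ℝ) 1, ‖derivWithin (derivWithin c (Icc 0 1)) (Icc 0 1) t‖
      ≤ C * ‖derivWithin c (Icc 0 1) t‖ ^ 2) {t : ℝ} (ht : t ∈ Icc (0 : ℝ) 1) :
    ‖derivWithin c (Icc 0 1) t - derivWithin c (Icc 0 1) 0‖
      ≤ C * m * ∫ s in (0 : ℝ)..1, ‖derivWithin c (Icc 0 1) s‖ := by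
  set d := derivWithin c (Icc 0 1) with hd
  have hu : UniqueDiffOn ℝ (Icc (0 : ℝ) 1) := uniqueDiffOn_Icc zero_lt_one
  have hd1 : ContDiffOn ℝ 1 d (Icc 0 1) := hc.derivWithin hu (by norm_num)
  have hdd : ContinuousOn (derivWithin d (Icc 0 1)) (Icc 0 1) :=
    hd1.continuousOn_derivWithin hu le_rfl
  have hsub : Icc 0 t ⊆ Icc (0 : ℝ) 1 := Icc_subset_Icc_right ht.2
  have hm0 : 0 ≤ m := (norm_nonneg _).trans (hm t ht)
  have hint : IntervalIntegrable (fun s ↦ ‖d s‖) MeasureTheory.volume 0 1 :=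
    (hd1.continuousOn.norm).intervalIntegrable_of_Icc zero_le_one
  have hint' : IntervalIntegrable (fun s ↦ ‖d s‖) MeasureTheory.volume 0 t :=
    ((hd1.continuousOn.norm).mono hsub).intervalIntegrable_of_Icc ht.1
  have key : ∫ s in (0 : ℝ)..t, derivWithin d (Icc 0 1) s = d t - d 0 := by
    refine intervalIntegral.integral_eq_sub_of_hasDerivAt_of_le ht.1
      (hd1.continuousOn.mono hsub) (fun s hs ↦ ?_)
      ((hdd.mono hsub).intervalIntegrable_of_Icc ht.1)
    have hs' : Icc (0 : ℝ) 1 ∈ 𝓝 s := Icc_mem_nhds hs.1 (hs.2.trans_le ht.2)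
    exact ((hd1.differentiableOn one_ne_zero s (mem_of_mem_nhds hs')).hasDerivWithinAt).hasDerivAt
      hs'
  calc ‖d t - d 0‖ = ‖∫ s in (0 : ℝ)..t, derivWithin d (Icc 0 1) s‖ := by rw [key]
    _ ≤ ∫ s in (0 : ℝ)..t, C * m * ‖d s‖ := by
        refine intervalIntegral.norm_integral_le_of_norm_le ht.1 ?_ (hint'.const_mul _)
        refine Eventually.of_forall fun s hs ↦ ?_
        have hs' : s ∈ Icc (0 : ℝ) 1 := hsub ⟨hs.1.le, hs.2⟩
        refine (h s hs').trans ?_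
        rw [mul_assoc, sq]
        exact mul_le_mul_of_nonneg_left
          (mul_le_mul_of_nonneg_right (hm s hs') (norm_nonneg _)) hC
    _ ≤ ∫ s in (0 : ℝ)..1, C * m * ‖d s‖ := by
        refine intervalIntegral.integral_mono_interval le_rfl ht.1 ht.2
          (Eventually.of_forall fun s ↦ by positivity) (hint.const_mul _)
    _ = _ := by rw [intervalIntegral.integral_const_mul]

/-- Division of the velocity of a nonconstant curve with `‖c''‖ ≤ C ‖c'‖²` by its maximal speed.
When the length is small, the normalized end velocities are nearly equal and nearly of norm `1`. -/
theorem exists_normalized_velocities {c : ℝ → F} (hc : ContDiffOn ℝ 2 c (Icc 0 1)) {C ℓ : ℝ}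
    (hC : 0 ≤ C)
    (h : ∀ t ∈ Icc (0 : ℝ) 1, ‖derivWithin (derivWithin c (Icc 0 1)) (Icc 0 1) t‖
      ≤ C * ‖derivWithin c (Icc 0 1) t‖ ^ 2)
    (hℓ : ∫ s in (0 : ℝ)..1, ‖derivWithin c (Icc 0 1) s‖ ≤ ℓ)
    (hne : ∃ t ∈ Icc (0 : ℝ) 1, c t ≠ c 0) :
    ∃ m : ℝ, 0 < m ∧ ∃ u₀ u₁ : F, derivWithin c (Icc 0 1) 0 = m • u₀ ∧ derivWithin c (Icc 0 1) 1 = m • u₁ ∧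
      ‖u₀‖ ≤ 1 ∧ 1 - C * ℓ ≤ ‖u₀‖ ∧ ‖u₁ - u₀‖ ≤ C * ℓ := by
  have hu : UniqueDiffOn ℝ (Icc (0 : ℝ) 1) := uniqueDiffOn_Icc zero_lt_one
  have hcont : ContinuousOn (derivWithin c (Icc 0 1)) (Icc 0 1) :=
    hc.continuousOn_derivWithin hu (by norm_num)
  obtain ⟨τ, hτ, hmax⟩ := isCompact_Icc.exists_isMaxOn (nonempty_Icc.2 zero_le_one) hcont.norm
  have hm : ∀ t ∈ Icc (0 : ℝ) 1, ‖derivWithin c (Icc 0 1) t‖ ≤ ‖derivWithin c (Icc 0 1) τ‖ :=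
    fun t ht ↦ hmax ht
  set d := derivWithin c (Icc 0 1) with hd
  set m := ‖d τ‖ with hmdef
  have hm0 : 0 < m := by
    refine (norm_nonneg _).lt_of_ne fun h0 ↦ ?_
    obtain ⟨t, ht, hct⟩ := hne
    refine hct ((convex_Icc (0 : ℝ) 1).is_const_of_fderivWithin_eq_zero (𝕜 := ℝ)
      (hc.differentiableOn two_ne_zero) (fun s hs ↦ ?_) ht ⟨le_rfl, zero_le_one⟩)
    have : d s = 0 := norm_le_zero_iff.1 ((hm s hs).trans_eq h0.symm)
    ext
    simpa [hd, derivWithin] using this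
  have key : ∀ t ∈ Icc (0 : ℝ) 1, ‖m⁻¹ • d t - m⁻¹ • d 0‖ ≤ C * ℓ := fun t ht ↦ by
    rw [← smul_sub, norm_smul, norm_inv, Real.norm_of_nonneg hm0.le, inv_mul_le_iff₀ hm0]
    refine (norm_derivWithin_sub_le hc hC hm h ht).trans ?_
    calc C * m * _ ≤ C * m * ℓ := mul_le_mul_of_nonneg_left hℓ (by positivity)
      _ = _ := by ring
  have hone : ‖m⁻¹ • d τ‖ = 1 := by
    rw [norm_smul, norm_inv, Real.norm_of_nonneg hm0.le, ← hmdef, inv_mul_cancel₀ hm0.ne']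
  refine ⟨m, hm0, m⁻¹ • d 0, m⁻¹ • d 1, (smul_inv_smul₀ hm0.ne' _).symm,
    (smul_inv_smul₀ hm0.ne' _).symm, ?_, ?_, key 1 ⟨zero_le_one, le_rfl⟩⟩
  · rw [norm_smul, norm_inv, Real.norm_of_nonneg hm0.le, inv_mul_le_iff₀ hm0, mul_one]
    exact hm 0 ⟨le_rfl, zero_le_one⟩
  · have := norm_sub_norm_le (m⁻¹ • d τ) (m⁻¹ • d 0)
    linarith [key τ hτ]

end Calculus

/-! ### Bilinear forms that are bounded below -/

section BilinearForms

variable {F G : Type*} [NormedAddCommGroup F] [NormedSpace ℝ F] [FiniteDimensional ℝ F]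
  [NormedAddCommGroup G] [NormedSpace ℝ G]

/-- A linear map close to an injective one on a finite-dimensional space is bounded below, with a
uniform constant. -/
theorem exists_forall_norm_sub_lt_le_norm_apply (B : F →L[ℝ] G) (hB : ∀ v, B v = 0 → v = 0) :
    ∃ δ > 0, ∀ B' : F →L[ℝ] G, ‖B' - B‖ < δ → ∀ v, δ * ‖v‖ ≤ ‖B' v‖ := by
  obtain ⟨K, hK, hanti⟩ := B.toLinearMap.exists_antilipschitzWith (LinearMap.ker_eq_bot'.2 hB)
  have hK' : (0 : ℝ) < K := hK
  refine ⟨(K : ℝ)⁻¹ / 2, by positivity, fun B' h v ↦ ?_⟩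
  have h1 : ‖v‖ ≤ K * ‖B v‖ := by simpa using hanti.le_mul_dist v 0
  have h2 : ‖(B' - B) v‖ ≤ (K : ℝ)⁻¹ / 2 * ‖v‖ :=
    ((B' - B).le_opNorm v).trans (mul_le_mul_of_nonneg_right h.le (norm_nonneg _))
  have h3 : ‖B v‖ ≤ ‖B' v‖ + ‖(B' - B) v‖ := by
    have := norm_sub_le (B' v) ((B' - B) v)
    simpa using this
  have h4 : (K : ℝ)⁻¹ * ‖v‖ ≤ ‖B v‖ := by rwa [inv_mul_le_iff₀ hK']
  linarith

/-- The geodesic equation with lowered index, `B a + Γ = 0`, bounds the acceleration `a` when `B` is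
bounded below by `δ`. -/
theorem norm_acceleration_le {F : Type*} [NormedAddCommGroup F] [NormedSpace ℝ F]
    {B : F →L[ℝ] F →L[ℝ] ℝ} {a : F} {Γ : F → ℝ} {δ R : ℝ} (hδ : 0 < δ) (hR : 0 ≤ R)
    (hB : δ * ‖a‖ ≤ ‖B a‖) (hΓ : ∀ w, |Γ w| ≤ R * ‖w‖) (h : ∀ w, B a w + Γ w = 0) :
    ‖a‖ ≤ R / δ := by
  rw [le_div_iff₀ hδ, mul_comm]
  refine hB.trans ((B a).opNorm_le_bound hR fun w ↦ ?_)
  rw [Real.norm_eq_abs, eq_neg_of_add_eq_zero_left (h w), abs_neg]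
  exact hΓ w

end BilinearForms

/-! ### Tensor fields in charts -/

section Charts

variable {n : ℕ} {M : Type*} [TopologicalSpace M] [ChartedSpace (E n) M]

/-- A shortcut for instance search, which otherwise runs out of time. -/
noncomputable instance normedAddCommGroupBilin :
    NormedAddCommGroup (E n →L[ℝ] E n →L[ℝ] ℝ) :=
  ContinuousLinearMap.toNormedAddCommGroup

theorem WhitneyTendsto.eventually_norm_localRep_sub_lt {k : ℕ} {u : ℕ → BilinField n M}
    {b : BilinField n M} (h : WhitneyTendsto k u b) {x₀ : M} {K : Set (E n)} (hK : IsCompact K)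
    (hKt : K ⊆ (extChartAt (𝓡 n) x₀).target) {ε : ℝ} (hε : 0 < ε) :
    ∀ᶠ α in atTop, ∀ y ∈ K, ‖localRep (u α) x₀ y - localRep b x₀ y‖ < ε := by
  filter_upwards [h x₀ K hK hKt 0 (Nat.zero_le k) ε hε] with α hα y hy
  have := ((iteratedFDeriv ℝ 0 (localRep (u α) x₀) y - iteratedFDeriv ℝ 0 (localRep b x₀) y).le_opNorm
    (fun _ : Fin 0 ↦ (0 : E n))).trans_lt (by simpa using hα y hy)
  simpa using this

theorem abs_christoffel_le {g : BilinField n M} {x₀ : M} {y : E n} {R : ℝ}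
    (hR : ‖iteratedFDeriv ℝ 1 (localRep g x₀) y‖ ≤ R) (u v w : E n) :
    |christoffel g x₀ y u v w| ≤ 3 / 2 * R * ‖u‖ * ‖v‖ * ‖w‖ := by
  have key : ∀ a b c : E n, |fderiv ℝ (localRep g x₀) y a b c| ≤ R * ‖a‖ * ‖b‖ * ‖c‖ :=
    fun a b c ↦ by
      have h1 : ‖fderiv ℝ (localRep g x₀) y a‖ ≤ R * ‖a‖ := by
        have := (iteratedFDeriv ℝ 1 (localRep g x₀) y).le_opNorm (fun _ ↦ a)
        rw [iteratedFDeriv_one_apply] at this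
        refine this.trans ?_
        simpa using mul_le_mul_of_nonneg_right hR (norm_nonneg a)
      rw [← Real.norm_eq_abs]
      exact ((fderiv ℝ (localRep g x₀) y a).le_opNorm₂ b c).trans (by gcongr)
  have h1 := abs_le.1 (key u v w)
  have h2 := abs_le.1 (key v u w)
  have h3 := abs_le.1 (key w u v)
  have e2 : R * ‖v‖ * ‖u‖ * ‖w‖ = R * ‖u‖ * ‖v‖ * ‖w‖ := by ring
  have e3 : R * ‖w‖ * ‖u‖ * ‖v‖ = R * ‖u‖ * ‖v‖ * ‖w‖ := by ring
  have e4 : 3 / 2 * R * ‖u‖ * ‖v‖ * ‖w‖ = 3 / 2 * (R * ‖u‖ * ‖v‖ * ‖w‖) := by ring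
  rw [e2] at h2
  rw [e3] at h3
  unfold christoffel
  rw [e4, abs_le]
  constructor <;> linarith [h1.1, h1.2, h2.1, h2.2, h3.1, h3.2]

variable (n) in
/-- The derivative at `q` of the chart centred at `x₀`. -/
noncomputable abbrev chartDeriv (x₀ q : M) : TangentSpace (𝓡 n) q →L[ℝ] E n :=
  mfderiv (𝓡 n) 𝓘(ℝ, E n) (extChartAt (𝓡 n) x₀) q

variable [IsManifold (𝓡 n) ∞ M]

/-- The chart expression of `b`, evaluated on the chart images of tangent vectors at `q`, gives back
`b`. -/
theorem localRep_chartDeriv (b : BilinField n M) {x₀ q : M}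
    (hq : q ∈ (extChartAt (𝓡 n) x₀).source) (v w : TangentSpace (𝓡 n) q) :
    localRep b x₀ (extChartAt (𝓡 n) x₀ q) (chartDeriv n x₀ q v) (chartDeriv n x₀ q w)
      = b q v w := by
  have : IsManifold (𝓡 n) 1 M := .of_le (n := ∞) (by norm_cast)
  have h := mfderivWithin_extChartAt_symm_comp_mfderiv_extChartAt' (I := 𝓡 n) hq
  rw [ModelWithCorners.range_eq_univ, mfderivWithin_univ] at h
  rw [localRep_apply]
  -- `(extChartAt x₀).symm (extChartAt x₀ q)` is not syntactically `q`, so the derivative `A` of the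
  -- inverse chart is generalized before its codomain is rewritten to the tangent space at `q`.
  generalize hA : mfderiv 𝓘(ℝ, E n) (𝓡 n) (extChartAt (𝓡 n) x₀).symm (extChartAt (𝓡 n) x₀ q) = A at h
  revert A
  rw [(extChartAt (𝓡 n) x₀).left_inv hq]
  intro A hA h
  have h' : ∀ u : TangentSpace (𝓡 n) q, A (chartDeriv n x₀ q u) = u := fun u ↦ DFunLike.congr_fun h u
  exact congrArg₂ (fun v w ↦ b q v w) (h' v) (h' w)


/-- At the centre of the chart, `localRep` is as smooth as the tensor field: near that point it is the
field read in the trivialization of the bundle of bilinear forms. -/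
theorem contDiffAt_localRep {b : BilinField n M} {k : ℕ}
    (hb : ContMDiff (𝓡 n) ((𝓡 n).prod 𝓘(ℝ, E n →L[ℝ] E n →L[ℝ] ℝ)) k
      (fun x ↦ Bundle.TotalSpace.mk' (E n →L[ℝ] E n →L[ℝ] ℝ) x (b x))) (x₀ : M) :
    ContDiffAt ℝ k (localRep b x₀) (extChartAt (𝓡 n) x₀ x₀) := by
  have : IsManifold (𝓡 n) 1 M := .of_le (n := ∞) (by norm_cast)
  have h := ((contMDiffAt_hom_bundle _).1 (hb x₀)).2
  have hs : ContMDiffAt 𝓘(ℝ, E n) (𝓡 n) k (extChartAt (𝓡 n) x₀).symm (extChartAt (𝓡 n) x₀ x₀) :=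
    ((contMDiffOn_extChartAt_symm (n := ∞) x₀).contMDiffAt
      (extChartAt_target_mem_nhds x₀)).of_le (by exact_mod_cast le_top)
  have h' := ContMDiffAt.comp_of_eq (x := extChartAt (𝓡 n) x₀ x₀) h hs (extChartAt_to_inv x₀)
  rw [← contMDiffAt_iff_contDiffAt]
  refine h'.congr_of_eventuallyEq ?_
  filter_upwards [extChartAt_target_mem_nhds (I := 𝓡 n) x₀] with y hy
  have hq : (extChartAt (𝓡 n) x₀).symm y ∈ (chartAt (E n) x₀).source := by
    rw [← extChartAt_source (𝓡 n)]
    exact (extChartAt (𝓡 n) x₀).map_target hy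
  have hsymm := TangentBundle.symmL_trivializationAt (I := 𝓡 n) hq
  rw [ModelWithCorners.range_eq_univ, mfderivWithin_univ, (extChartAt (𝓡 n) x₀).right_inv hy] at hsymm
  ext v w
  rw [localRep_apply, Function.comp_apply]
  have key := inCoordinates_apply_eq₂ (F₁ := E n) (F₂ := E n) (F₃ := ℝ)
    (E₁ := fun x : M ↦ TangentSpace (𝓡 n) x)
    (E₂ := fun x : M ↦ TangentSpace (𝓡 n) x) (E₃ := Bundle.Trivial M ℝ)
    (ϕ := b ((extChartAt (𝓡 n) x₀).symm y)) (v := v) (w := w) (x₀ := x₀) (h₁x := hq) (h₂x := hq)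
    (h₃x := mem_univ _)
  refine Eq.trans ?_ key.symm
  have hv : ∀ v : E n, mfderiv 𝓘(ℝ, E n) (𝓡 n) (extChartAt (𝓡 n) x₀).symm y v =
      (trivializationAt (E n) (TangentSpace (𝓡 n)) x₀).symm ((extChartAt (𝓡 n) x₀).symm y) v :=
    fun v ↦ (DFunLike.congr_fun hsymm.symm v).trans (Bundle.Trivialization.symmL_apply _ hq v)
  refine (congrArg₂ (fun v w ↦ b ((extChartAt (𝓡 n) x₀).symm y) v w) (hv v) (hv w)).trans ?_
  generalize b ((extChartAt (𝓡 n) x₀).symm y) _ _ = r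
  exact (DFunLike.congr_fun (Bundle.Trivial.linearMapAt_trivialization ℝ M ℝ _) r).symm

/-- Near a point where the limit field is nondegenerate, almost all fields of a convergent sequence
have uniformly bounded first derivatives and are uniformly nondegenerate. -/
theorem WhitneyTendsto.exists_uniform_bounds {k : ℕ} (hk : 1 ≤ k) {u : ℕ → BilinField n M}
    {b : BilinField n M} (h : WhitneyTendsto k u b)
    (hb : ContMDiff (𝓡 n) ((𝓡 n).prod 𝓘(ℝ, E n →L[ℝ] E n →L[ℝ] ℝ)) k
      (fun x ↦ Bundle.TotalSpace.mk' (E n →L[ℝ] E n →L[ℝ] ℝ) x (b x))) (x₀ : M)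
    (hb₀ : ∀ v, localRep b x₀ (extChartAt (𝓡 n) x₀ x₀) v = 0 → v = 0) :
    ∃ K ∈ 𝓝 (extChartAt (𝓡 n) x₀ x₀), ∃ δ : ℝ, 0 < δ ∧ ∃ R : ℝ,
      K ⊆ (extChartAt (𝓡 n) x₀).target ∧ IsCompact K ∧
      ∀ᶠ α in atTop, ∀ y ∈ K, ‖iteratedFDeriv ℝ 1 (localRep (u α) x₀) y‖ ≤ R ∧
        ∀ v, δ * ‖v‖ ≤ ‖localRep (u α) x₀ y v‖ := by
  obtain ⟨δ, hδ, hδ'⟩ := exists_forall_norm_sub_lt_le_norm_apply _ hb₀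
  have hcd := contDiffAt_localRep hb x₀
  set y₀ := extChartAt (𝓡 n) x₀ x₀ with hy₀
  have h0 : ∀ᶠ y in 𝓝 y₀, ‖localRep b x₀ y - localRep b x₀ y₀‖ < δ / 2 := by
    simpa only [dist_eq_norm] using Metric.tendsto_nhds.1 hcd.continuousAt (δ / 2) (half_pos hδ)
  have h1 : ∀ᶠ y in 𝓝 y₀, ‖iteratedFDeriv ℝ 1 (localRep b x₀) y‖
      < ‖iteratedFDeriv ℝ 1 (localRep b x₀) y₀‖ + 1 :=
    (hcd.continuousAt_iteratedFDeriv (k := 1) (by exact_mod_cast hk)).norm.eventually_lt_const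
      (lt_add_one _)
  obtain ⟨K, hK, hKs, hKc⟩ := local_compact_nhds
    (inter_mem (inter_mem h0 h1) (extChartAt_target_mem_nhds (I := 𝓡 n) x₀))
  refine ⟨K, hK, δ, hδ, ‖iteratedFDeriv ℝ 1 (localRep b x₀) y₀‖ + 1 + 1,
    fun y hy ↦ (hKs hy).2, hKc, ?_⟩
  filter_upwards [h.eventually_norm_localRep_sub_lt hKc (fun y hy ↦ (hKs hy).2) (half_pos hδ),
    h x₀ K hKc (fun y hy ↦ (hKs hy).2) 1 hk 1 one_pos] with α h2 h3 y hy
  constructor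
  · have := norm_sub_norm_le (iteratedFDeriv ℝ 1 (localRep (u α) x₀) y)
      (iteratedFDeriv ℝ 1 (localRep b x₀) y)
    have h4 : ‖iteratedFDeriv ℝ 1 (localRep b x₀) y‖ < _ := (hKs hy).1.2
    linarith [h3 y hy]
  · refine hδ' _ ?_
    have h5 : ‖localRep b x₀ y - localRep b x₀ y₀‖ < δ / 2 := (hKs hy).1.1
    have := norm_sub_le_norm_sub_add_norm_sub (localRep (u α) x₀ y) (localRep b x₀ y)
      (localRep b x₀ y₀)
    linarith [h2 y hy]

end Charts

/-! ### Velocities of curves in charts -/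

section Curves

variable {n : ℕ} {M : Type*} [TopologicalSpace M] [ChartedSpace (E n) M] [IsManifold (𝓡 n) ∞ M]

theorem contDiffOn_extChartAt_comp {γ : ℝ → M} {s : Set ℝ} {m : ℕ}
    (hγ : ContMDiffOn 𝓘(ℝ, ℝ) (𝓡 n) m γ s) {x₀ : M}
    (h : ∀ t ∈ s, γ t ∈ (extChartAt (𝓡 n) x₀).source) :
    ContDiffOn ℝ m (fun t ↦ extChartAt (𝓡 n) x₀ (γ t)) s := by
  rw [← contMDiffOn_iff_contDiffOn]
  refine ((contMDiffOn_extChartAt (I := 𝓡 n) (x := x₀) (n := ∞)).of_le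
    (by exact_mod_cast le_top)).comp hγ fun t ht ↦ ?_
  simpa using h t ht

theorem derivWithin_extChartAt_comp {γ : ℝ → M} {m : ℕ} (hm : m ≠ 0)
    (hγ : ContMDiffOn 𝓘(ℝ, ℝ) (𝓡 n) m γ (Icc 0 1)) {x₀ : M} {t : ℝ} (ht : t ∈ Icc (0 : ℝ) 1)
    (h : γ t ∈ (extChartAt (𝓡 n) x₀).source) :
    derivWithin (fun t ↦ extChartAt (𝓡 n) x₀ (γ t)) (Icc 0 1) t
      = chartDeriv n x₀ (γ t) (velocity γ t) := by
  have : IsManifold (𝓡 n) 1 M := .of_le (n := ∞) (by norm_cast)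
  have h1 := (hγ.mdifferentiableOn (by exact_mod_cast hm) t ht).hasMFDerivWithinAt
  have h2 := (mdifferentiableAt_extChartAt (I := 𝓡 n) (x := x₀) (by simpa using h)).hasMFDerivAt
  let L : ℝ →L[ℝ] E n := (chartDeriv n x₀ (γ t)).comp (mfderivWithin 𝓘(ℝ, ℝ) (𝓡 n) γ (Icc 0 1) t)
  have h3 : HasFDerivWithinAt (fun t ↦ extChartAt (𝓡 n) x₀ (γ t)) L (Icc 0 1) t :=
    (h2.comp_hasMFDerivWithinAt t h1).hasFDerivWithinAt
  exact h3.hasDerivWithinAt.derivWithin (uniqueDiffOn_Icc zero_lt_one t ht)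

theorem deriv_extChartAt_comp {γ : ℝ → M} {t : ℝ}
    (hγ : MDifferentiableAt 𝓘(ℝ, ℝ) (𝓡 n) γ t) {x₀ : M}
    (h : γ t ∈ (extChartAt (𝓡 n) x₀).source) :
    deriv (fun t ↦ extChartAt (𝓡 n) x₀ (γ t)) t
      = chartDeriv n x₀ (γ t) (mfderiv 𝓘(ℝ, ℝ) (𝓡 n) γ t (1 : ℝ)) := by
  have : IsManifold (𝓡 n) 1 M := .of_le (n := ∞) (by norm_cast)
  have h2 := (mdifferentiableAt_extChartAt (I := 𝓡 n) (x := x₀) (by simpa using h)).hasMFDerivAt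
  let L : ℝ →L[ℝ] E n := (chartDeriv n x₀ (γ t)).comp (mfderiv 𝓘(ℝ, ℝ) (𝓡 n) γ t)
  have h3 : HasFDerivAt (fun t ↦ extChartAt (𝓡 n) x₀ (γ t)) L t :=
    (h2.comp t hγ.hasMFDerivAt).hasFDerivAt
  exact h3.hasDerivAt.deriv

/-- Near the centre of a chart, Euclidean norms in the chart are bounded by a multiple of the
Riemannian norms. -/
theorem exists_enorm_chartDeriv_le
    [Bundle.RiemannianBundle (fun x : M ↦ TangentSpace (𝓡 n) x)]
    [IsContMDiffRiemannianBundle (𝓡 n) ∞ (E n) (fun x : M ↦ TangentSpace (𝓡 n) x)] (x₀ : M) :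
    ∃ C : NNReal, ∀ᶠ q in 𝓝 x₀, ∀ v : TangentSpace (𝓡 n) q, ‖chartDeriv n x₀ q v‖ₑ ≤ C * ‖v‖ₑ := by
  have : IsManifold (𝓡 n) 1 M := .of_le (n := ∞) (by norm_cast)
  have : IsContinuousRiemannianBundle (E n) (fun x : M ↦ TangentSpace (𝓡 n) x) := by
    obtain ⟨g, hg, h⟩ := IsContMDiffRiemannianBundle.exists_contMDiff (IB := 𝓡 n) (n := ∞)
      (F := E n) (E := fun x : M ↦ TangentSpace (𝓡 n) x)
    exact ⟨g, hg.continuous, h⟩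
  obtain ⟨C, hC, h⟩ := eventually_norm_trivializationAt_lt (E n)
    (fun x : M ↦ TangentSpace (𝓡 n) x) x₀
  lift C to NNReal using hC.le
  refine ⟨C, ?_⟩
  filter_upwards [h, chart_source_mem_nhds (E n) x₀] with q hq hqs v
  have h1 := ((Bundle.Trivialization.continuousLinearMapAt ℝ
    (trivializationAt (E n) (fun x : M ↦ TangentSpace (𝓡 n) x) x₀) q).le_opNorm v).trans
    (mul_le_mul_of_nonneg_right hq.le (norm_nonneg v))
  have h2 : chartDeriv n x₀ q v = Bundle.Trivialization.continuousLinearMapAt ℝ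
    (trivializationAt (E n) (fun x : M ↦ TangentSpace (𝓡 n) x) x₀) q v :=
    (DFunLike.congr_fun (TangentBundle.continuousLinearMapAt_trivializationAt (I := 𝓡 n) hqs) v).symm
  rw [h2]
  simp only [enorm]
  exact_mod_cast h1

end Curves

/-! ### Semicontinuity of the tangent spaces of a submanifold -/

section Submanifolds

variable {n : ℕ} {M : Type*} [TopologicalSpace M] [ChartedSpace (E n) M] [IsManifold (𝓡 n) ∞ M]

theorem contDiffAt_extChartAt_comp_symm
    {φ : OpenPartialHomeomorph (M × M) (ModelProd (E n) (E n))}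
    (hφ : φ ∈ IsManifold.maximalAtlas ((𝓡 n).prod (𝓡 n)) ∞ (M × M)) {pr : M × M → M}
    (hpr : ContMDiff ((𝓡 n).prod (𝓡 n)) (𝓡 n) ∞ pr) {x₀ : M} {y : M × M} (hy : y ∈ φ.source)
    (hy₀ : pr y ∈ (extChartAt (𝓡 n) x₀).source) :
    ContDiffAt ℝ ∞ (fun z : E n × E n ↦ extChartAt (𝓡 n) x₀ (pr (φ.symm z))) (φ y) := by
  rw [← contMDiffAt_iff_contDiffAt]
  have h1 : ContMDiffAt 𝓘(ℝ, E n × E n) ((𝓡 n).prod (𝓡 n)) ∞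
      (fun z : E n × E n ↦ φ.symm z) (φ y) := by
    rw [modelWithCornersSelf_prod]
    have := contMDiffAt_symm_of_mem_maximalAtlas hφ (φ.map_source hy)
    exact this
  have h2 : ContMDiffAt 𝓘(ℝ, E n × E n) (𝓡 n) ∞ (fun z : E n × E n ↦ pr (φ.symm z)) (φ y) :=
    hpr.contMDiffAt.comp _ h1
  have h3 : ContMDiffAt (𝓡 n) 𝓘(ℝ, E n) ∞ (extChartAt (𝓡 n) x₀) (pr (φ.symm (φ y))) := by
    rw [φ.left_inv hy]
    exact contMDiffAt_extChartAt' (by simpa using hy₀)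
  exact ContMDiffAt.comp (M := E n × E n) (φ y) h3 h2

omit [IsManifold (𝓡 n) ∞ M] in
theorem contDiffAt_chart_comp
    {φ : OpenPartialHomeomorph (M × M) (ModelProd (E n) (E n))}
    (hφ : φ ∈ IsManifold.maximalAtlas ((𝓡 n).prod (𝓡 n)) ∞ (M × M))
    {τ : ℝ → M × M} {t : ℝ} (hτ : ContMDiffAt 𝓘(ℝ, ℝ) ((𝓡 n).prod (𝓡 n)) ∞ τ t)
    (ht : τ t ∈ φ.source) : ContDiffAt ℝ ∞ (F := E n × E n) (fun s ↦ φ (τ s)) t := by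
  rw [← contMDiffAt_iff_contDiffAt, modelWithCornersSelf_prod]
  exact (contMDiffAt_of_mem_maximalAtlas hφ ht).comp t hτ

/-- The velocity of `pr ∘ τ` in the chart centred at `x₀` is computed from the velocity of `τ` in the
chart `φ` of `M × M`. It is used with `pr` one of the two projections. -/
theorem chartDeriv_mfderiv_comp
    {φ : OpenPartialHomeomorph (M × M) (ModelProd (E n) (E n))}
    (hφ : φ ∈ IsManifold.maximalAtlas ((𝓡 n).prod (𝓡 n)) ∞ (M × M)) {pr : M × M → M}
    (hpr : ContMDiff ((𝓡 n).prod (𝓡 n)) (𝓡 n) ∞ pr) {x₀ : M} {τ : ℝ → M × M} {t : ℝ}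
    (hτ : ContMDiffAt 𝓘(ℝ, ℝ) ((𝓡 n).prod (𝓡 n)) ∞ τ t) (ht : τ t ∈ φ.source)
    (ht₀ : pr (τ t) ∈ (extChartAt (𝓡 n) x₀).source) :
    chartDeriv n x₀ (pr (τ t)) (mfderiv 𝓘(ℝ, ℝ) (𝓡 n) (fun s ↦ pr (τ s)) t (1 : ℝ)) =
      fderiv ℝ (fun z : E n × E n ↦ extChartAt (𝓡 n) x₀ (pr (φ.symm z))) (φ (τ t))
        (deriv (F := E n × E n) (fun s ↦ φ (τ s)) t) := by
  have hmd : MDifferentiableAt 𝓘(ℝ, ℝ) (𝓡 n) (fun s ↦ pr (τ s)) t :=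
    (hpr.contMDiffAt.comp t hτ).mdifferentiableAt (by simp)
  rw [← deriv_extChartAt_comp hmd ht₀]
  have h1 := ((contDiffAt_extChartAt_comp_symm hφ hpr ht ht₀).differentiableAt (by simp)).hasFDerivAt
  have h2 := ((contDiffAt_chart_comp hφ hτ ht).differentiableAt (by simp)).hasDerivAt
  rw [← (h1.comp_hasDerivAt t h2).deriv]
  refine EventuallyEq.deriv_eq ?_
  filter_upwards [hτ.continuousAt.preimage_mem_nhds (φ.open_source.mem_nhds ht)] with s hs
  simp [φ.left_inv hs]

theorem deriv_mem_of_eventually_mem {F : Type*} [NormedAddCommGroup F] [NormedSpace ℝ F]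
    {W : Submodule ℝ F} (hW : IsClosed (W : Set F)) {ψ : ℝ → F} {t : ℝ}
    (hψ : DifferentiableAt ℝ ψ t) (h : ∀ᶠ s in 𝓝 t, ψ s ∈ W) : deriv ψ t ∈ W := by
  refine hW.mem_of_tendsto (hasDerivAt_iff_tendsto_slope.1 hψ.hasDerivAt) ?_
  filter_upwards [h.filter_mono nhdsWithin_le_nhds] with s hs
  exact W.smul_mem _ (W.sub_mem hs h.self_of_nhds)

/-- Tangent spaces of a submanifold are lower semicontinuous: each tangent vector at `x` extends to a
family of tangent vectors at the points of `P` near `x` whose chart expressions are continuous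
at `x`. -/
theorem exists_tangentTo_tendsto {P : Set (M × M)} (hP : IsSubmanifold (n := n) P) {x : M × M}
    (hx : x ∈ P) {x₀ y₀ : M} (hx₁ : x.1 ∈ (extChartAt (𝓡 n) x₀).source)
    (hx₂ : x.2 ∈ (extChartAt (𝓡 n) y₀).source) {w : TProd n x} (hw : w ∈ tangentTo (n := n) P x) :
    ∃ f : ∀ y : M × M, TProd n y, (∀ᶠ y in 𝓝[P] x, f y ∈ tangentTo (n := n) P y) ∧
      Tendsto (fun y ↦ chartDeriv n x₀ y.1 (f y).1) (𝓝[P] x) (𝓝 (chartDeriv n x₀ x.1 w.1)) ∧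
      Tendsto (fun y ↦ chartDeriv n y₀ y.2 (f y).2) (𝓝[P] x) (𝓝 (chartDeriv n y₀ x.2 w.2)) := by
  induction hw using Submodule.span_induction with
  | zero =>
    refine ⟨fun y ↦ 0, Eventually.of_forall fun y ↦ zero_mem _, ?_, ?_⟩
    · simpa using tendsto_const_nhds (x := (0 : E n))
    · simpa using tendsto_const_nhds (x := (0 : E n))
  | add v w _ _ hv hw =>
    obtain ⟨f, hf, hf1, hf2⟩ := hv
    obtain ⟨g, hg, hg1, hg2⟩ := hw
    refine ⟨fun y ↦ f y + g y, by filter_upwards [hf, hg] with y h1 h2 using add_mem h1 h2, ?_, ?_⟩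
    · simpa using hf1.add hg1
    · simpa using hf2.add hg2
  | smul r v _ hv =>
    obtain ⟨f, hf, hf1, hf2⟩ := hv
    refine ⟨fun y ↦ r • f y, by filter_upwards [hf] with y h1 using Submodule.smul_mem _ _ h1, ?_, ?_⟩
    · simpa using hf1.const_smul r
    · simpa using hf2.const_smul r
  | mem v hv =>
    obtain ⟨σ, rfl, hσP, hσ, hv1, hv2⟩ := hv
    obtain ⟨φ, hφ, hxφ, W, hW⟩ := hP _ hx
    set ξ : E n × E n := deriv (F := E n × E n) (fun s ↦ φ (σ s)) 0 with hξ
    have hξW : ξ ∈ W := by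
      refine deriv_mem_of_eventually_mem W.closed_of_finiteDimensional
        ((contDiffAt_chart_comp hφ hσ hxφ).differentiableAt (by simp)) ?_
      filter_upwards [hσP, hσ.continuousAt.preimage_mem_nhds (φ.open_source.mem_nhds hxφ)] with s h1 h2
      exact (hW _ h2).1 h1
    -- The tangent vector at `y` is the velocity of the curve that is a straight line of direction
    -- `ξ` in the chart `φ`; this line stays in `W`.
    let Φ : M × M → E n × E n := φ
    let Ψ : E n × E n → M × M := φ.symm
    let τ : M × M → ℝ → M × M := fun y s ↦ Ψ (Φ y + s • ξ)
    have hτ0 : ∀ y ∈ φ.source, τ y 0 = y := fun y hy ↦ by simpa [τ] using φ.left_inv hy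
    have hline : ∀ y, ContDiff ℝ ∞ fun s : ℝ ↦ Φ y + s • ξ := fun y ↦ by fun_prop
    have hτs : ∀ y ∈ φ.source, ContMDiffAt 𝓘(ℝ, ℝ) ((𝓡 n).prod (𝓡 n)) ∞ (τ y) 0 := fun y hy ↦ by
      have h1 : ContMDiffAt 𝓘(ℝ, E n × E n) ((𝓡 n).prod (𝓡 n)) ∞ Ψ (Φ y) := by
        rw [modelWithCornersSelf_prod]
        have := contMDiffAt_symm_of_mem_maximalAtlas hφ (φ.map_source hy)
        exact this
      have h2 : ContMDiffAt 𝓘(ℝ, ℝ) 𝓘(ℝ, E n × E n) ∞ (fun s : ℝ ↦ Φ y + s • ξ) 0 :=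
        (hline y).contMDiff.contMDiffAt
      exact ContMDiffAt.comp_of_eq h1 h2 (by simp [Φ])
    have hτφ : ∀ y ∈ φ.source, ∀ᶠ s in 𝓝 (0 : ℝ), τ y s ∈ φ.source ∧
        Φ (τ y s) = Φ y + s • ξ := fun y hy ↦ by
      have : ∀ᶠ s in 𝓝 (0 : ℝ), Φ y + s • ξ ∈ φ.target := by
        refine (hline y).continuous.continuousAt.preimage_mem_nhds (φ.open_target.mem_nhds ?_)
        simpa using φ.map_source hy
      filter_upwards [this] with s hs
      exact ⟨φ.map_target hs, φ.right_inv hs⟩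
    have hτd : ∀ y ∈ φ.source, deriv (fun s ↦ Φ (τ y s)) 0 = ξ := fun y hy ↦ by
      have h : (fun s ↦ Φ (τ y s)) =ᶠ[𝓝 0] fun s ↦ Φ y + s • ξ := (hτφ y hy).mono fun s h ↦ h.2
      rw [h.deriv_eq]
      simpa using (((hasDerivAt_id (0 : ℝ)).smul_const ξ).const_add (Φ y)).deriv
    let f : ∀ y : M × M, TProd n y := fun y ↦
      (mfderiv 𝓘(ℝ, ℝ) (𝓡 n) (fun t ↦ (τ y t).1) 0 (1 : ℝ),
        mfderiv 𝓘(ℝ, ℝ) (𝓡 n) (fun t ↦ (τ y t).2) 0 (1 : ℝ))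
    have hs : ∀ᶠ y in 𝓝[P] (σ 0), y ∈ φ.source :=
      nhdsWithin_le_nhds (φ.open_source.mem_nhds hxφ)
    have key : ∀ pr : M × M → M, ContMDiff ((𝓡 n).prod (𝓡 n)) (𝓡 n) ∞ pr → ∀ z₀ : M,
        pr (σ 0) ∈ (extChartAt (𝓡 n) z₀).source →
        Tendsto (fun y ↦ chartDeriv n z₀ (pr y)
          (mfderiv 𝓘(ℝ, ℝ) (𝓡 n) (fun t ↦ pr (τ y t)) 0 (1 : ℝ) : E n)) (𝓝[P] (σ 0))
          (𝓝 (chartDeriv n z₀ (pr (σ 0)) (mfderiv 𝓘(ℝ, ℝ) (𝓡 n) (fun t ↦ pr (σ t)) 0 (1 : ℝ)))) := by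
      intro pr hpr z₀ hz
      rw [chartDeriv_mfderiv_comp hφ hpr hσ hxφ hz]
      have hc : ContinuousAt (fun y ↦ fderiv ℝ
          (fun z : E n × E n ↦ extChartAt (𝓡 n) z₀ (pr (φ.symm z))) (Φ y)) (σ 0) :=
        ContinuousAt.comp (x := σ 0) (f := Φ)
          (((contDiffAt_extChartAt_comp_symm hφ hpr hxφ hz).fderiv_right (m := 0)
            (by norm_cast)).continuousAt)
          (φ.continuousAt hxφ)
      have hlim := ((hc.clm_apply (continuousAt_const (y := ξ))).tendsto).mono_left
        (nhdsWithin_le_nhds (s := P))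
      refine (hlim.congr' ?_ : Tendsto _ _ (𝓝 (fderiv ℝ
          (fun z : E n × E n ↦ extChartAt (𝓡 n) z₀ (pr (φ.symm z))) (Φ (σ 0)) ξ)))
      have hs' : ∀ᶠ y in 𝓝[P] (σ 0), pr y ∈ (extChartAt (𝓡 n) z₀).source :=
        nhdsWithin_le_nhds (hpr.continuous.continuousAt.preimage_mem_nhds
          ((isOpen_extChartAt_source z₀).mem_nhds hz))
      filter_upwards [hs, hs'] with y hy hy'
      have := chartDeriv_mfderiv_comp (x₀ := z₀) hφ hpr (hτs y hy) (by rwa [hτ0 y hy])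
        (by rwa [hτ0 y hy])
      rw [hτ0 y hy] at this
      exact (this.trans (congrArg _ (hτd y hy))).symm
    refine ⟨f, ?_, ?_, ?_⟩
    · filter_upwards [hs, self_mem_nhdsWithin] with y hy hyP
      refine Submodule.subset_span ⟨τ y, hτ0 y hy, ?_, hτs y hy, rfl, rfl⟩
      filter_upwards [hτφ y hy] with s hs
      refine (hW _ hs.1).2 ?_
      change Φ (τ y s) ∈ W
      rw [hs.2]
      exact W.add_mem ((hW y hy).1 hyP) (W.smul_mem _ hξW)
    · rw [hv1]
      exact key Prod.fst contMDiff_fst x₀ hx₁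
    · rw [hv2]
      exact key Prod.snd contMDiff_snd y₀ hx₂

end Submanifolds

/-! ### Normalized end velocities of short geodesics -/

section Normalization

variable {n : ℕ} {M : Type*} [TopologicalSpace M] [ChartedSpace (E n) M] [IsManifold (𝓡 n) ∞ M]

omit [IsManifold (𝓡 n) ∞ M] in
/-- In a chart, `‖c''‖ ≤ C ‖c'‖²` along geodesics, where `C` only depends on the bounds of the metric
and its first derivatives. -/
theorem IsGeodesic.norm_acceleration_le {g : BilinField n M} {γ : ℝ → M} (hγ : IsGeodesic g γ)
    {x₀ : M} {K : Set (E n)} {δ R : ℝ} (hδ : 0 < δ)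
    (hg : ∀ y ∈ K, ‖iteratedFDeriv ℝ 1 (localRep g x₀) y‖ ≤ R ∧
      ∀ v, δ * ‖v‖ ≤ ‖localRep g x₀ y v‖) {t : ℝ} (ht : t ∈ Icc (0 : ℝ) 1)
    (hs : γ t ∈ (extChartAt (𝓡 n) x₀).source) (hK : extChartAt (𝓡 n) x₀ (γ t) ∈ K) :
    ‖derivWithin (derivWithin (fun s ↦ extChartAt (𝓡 n) x₀ (γ s)) (Icc 0 1)) (Icc 0 1) t‖ ≤
      3 / 2 * R / δ * ‖derivWithin (fun s ↦ extChartAt (𝓡 n) x₀ (γ s)) (Icc 0 1) t‖ ^ 2 := by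
  set d := derivWithin (fun s ↦ extChartAt (𝓡 n) x₀ (γ s)) (Icc 0 1) with hd
  have hR : 0 ≤ R := (norm_nonneg _).trans (hg _ hK).1
  have := GeneralBoundary.norm_acceleration_le (a := derivWithin d (Icc 0 1) t)
    (Γ := fun w ↦ christoffel g x₀ (extChartAt (𝓡 n) x₀ (γ t)) (d t) (d t) w)
    (R := 3 / 2 * R * ‖d t‖ * ‖d t‖) hδ (by positivity) ((hg _ hK).2 _)
    (abs_christoffel_le (hg _ hK).1 (d t) (d t)) (hγ.2 x₀ t ht hs)
  refine this.trans_eq ?_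
  ring

/-- The Euclidean length in a chart is bounded by a multiple of the Riemannian length. -/
theorem integral_norm_derivWithin_le
    [Bundle.RiemannianBundle (fun x : M ↦ TangentSpace (𝓡 n) x)]
    {γ : ℝ → M} (hγ : ContMDiffOn 𝓘(ℝ, ℝ) (𝓡 n) 2 γ (Icc 0 1)) {x₀ : M}
    (hs : ∀ t ∈ Icc (0 : ℝ) 1, γ t ∈ (extChartAt (𝓡 n) x₀).source) {C : NNReal}
    (hC : ∀ t ∈ Icc (0 : ℝ) 1, ∀ v : TangentSpace (𝓡 n) (γ t),
      ‖chartDeriv n x₀ (γ t) v‖ₑ ≤ C * ‖v‖ₑ) {ℓ : ℝ} (hℓ₀ : 0 ≤ ℓ)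
    (hℓ : Manifold.pathELength (𝓡 n) γ 0 1 ≤ ENNReal.ofReal ℓ) :
    ∫ t in (0 : ℝ)..1, ‖derivWithin (fun s ↦ extChartAt (𝓡 n) x₀ (γ s)) (Icc 0 1) t‖
      ≤ C * ℓ := by
  have hc := contDiffOn_extChartAt_comp (m := 2) hγ hs
  have hcont := hc.continuousOn_derivWithin (uniqueDiffOn_Icc zero_lt_one) (by norm_num)
  have hmeas := (hcont.norm.mono Ioc_subset_Icc_self).aestronglyMeasurable (μ := MeasureTheory.volume)
    measurableSet_Ioc
  rw [intervalIntegral.integral_of_le zero_le_one,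
    MeasureTheory.integral_eq_lintegral_of_nonneg_ae (Eventually.of_forall fun t ↦ norm_nonneg _) hmeas]
  refine ENNReal.toReal_le_of_le_ofReal (by positivity) ?_
  rw [ENNReal.ofReal_mul (NNReal.coe_nonneg C), ENNReal.ofReal_coe_nnreal]
  refine le_trans ?_ (mul_le_mul_right hℓ _)
  rw [Manifold.pathELength_eq_lintegral_mfderivWithin_Icc,
    ← MeasureTheory.lintegral_const_mul' _ _ ENNReal.coe_ne_top]
  refine (MeasureTheory.lintegral_mono_set Ioc_subset_Icc_self).trans
    (MeasureTheory.setLIntegral_mono' measurableSet_Icc fun t ht ↦ ?_)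
  rw [derivWithin_extChartAt_comp (m := 2) two_ne_zero hγ ht (hs t ht), ofReal_norm]
  exact hC t ht _

/-- Orthogonality to `P` in the chart; it is unaffected by the rescaling of both end velocities by
the same factor. -/
theorem IsBoundaryGeodesic.localRep_sub_eq_zero {g : BilinField n M} {P : Set (M × M)} {γ : ℝ → M}
    (hγ : IsBoundaryGeodesic g P γ) {x₀ : M}
    (h0 : γ 0 ∈ (extChartAt (𝓡 n) x₀).source) (h1 : γ 1 ∈ (extChartAt (𝓡 n) x₀).source)
    {m : ℝ} (hm : m ≠ 0) {u₀ u₁ : E n}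
    (hu₀ : derivWithin (fun s ↦ extChartAt (𝓡 n) x₀ (γ s)) (Icc 0 1) 0 = m • u₀)
    (hu₁ : derivWithin (fun s ↦ extChartAt (𝓡 n) x₀ (γ s)) (Icc 0 1) 1 = m • u₁)
    {w : TProd n (γ 0, γ 1)} (hw : w ∈ tangentTo (n := n) P (γ 0, γ 1)) :
    localRep g x₀ (extChartAt (𝓡 n) x₀ (γ 0)) u₀ (chartDeriv n x₀ (γ 0) w.1) -
      localRep g x₀ (extChartAt (𝓡 n) x₀ (γ 1)) u₁ (chartDeriv n x₀ (γ 1) w.2) = 0 := by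
  have h := hγ.2.2 w hw
  rw [derivWithin_extChartAt_comp (m := 2) two_ne_zero hγ.1.1 ⟨le_rfl, zero_le_one⟩ h0] at hu₀
  rw [derivWithin_extChartAt_comp (m := 2) two_ne_zero hγ.1.1 ⟨zero_le_one, le_rfl⟩ h1] at hu₁
  unfold prodForm at h
  rw [← localRep_chartDeriv g h0, ← localRep_chartDeriv g h1, hu₀, hu₁] at h
  have h' : m * (localRep g x₀ (extChartAt (𝓡 n) x₀ (γ 0)) u₀ (chartDeriv n x₀ (γ 0) w.1) -
      localRep g x₀ (extChartAt (𝓡 n) x₀ (γ 1)) u₁ (chartDeriv n x₀ (γ 1) w.2)) = 0 := by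
    refine Eq.trans ?_ h
    simp [mul_sub]
  exact (mul_eq_zero.1 h').resolve_left hm

/-- A short nonconstant `(g, P)`-geodesic in a chart domain gives a pair of nearly equal vectors,
nearly of norm `1`, which is orthogonal to `P`. -/
theorem IsBoundaryGeodesic.exists_normalized_velocities
    [Bundle.RiemannianBundle (fun x : M ↦ TangentSpace (𝓡 n) x)]
    {g : BilinField n M} {P : Set (M × M)} {γ : ℝ → M}
    (hγ : IsBoundaryGeodesic g P γ) (hne : ∃ t ∈ Icc (0 : ℝ) 1, γ t ≠ γ 0) {x₀ : M} {K : Set (E n)}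
    {δ R : ℝ} (hδ : 0 < δ)
    (hg : ∀ y ∈ K, ‖iteratedFDeriv ℝ 1 (localRep g x₀) y‖ ≤ R ∧
      ∀ v, δ * ‖v‖ ≤ ‖localRep g x₀ y v‖)
    (hs : ∀ t ∈ Icc (0 : ℝ) 1, γ t ∈ (extChartAt (𝓡 n) x₀).source)
    (hK : ∀ t ∈ Icc (0 : ℝ) 1, extChartAt (𝓡 n) x₀ (γ t) ∈ K) {C : NNReal}
    (hC : ∀ t ∈ Icc (0 : ℝ) 1, ∀ v : TangentSpace (𝓡 n) (γ t),
      ‖chartDeriv n x₀ (γ t) v‖ₑ ≤ C * ‖v‖ₑ) {ℓ : ℝ} (hℓ₀ : 0 ≤ ℓ)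
    (hℓ : Manifold.pathELength (𝓡 n) γ 0 1 ≤ ENNReal.ofReal ℓ) :
    ∃ u : E n × E n, ‖u.1‖ ≤ 1 ∧ 1 - 3 / 2 * R / δ * (C * ℓ) ≤ ‖u.1‖ ∧
      ‖u.2 - u.1‖ ≤ 3 / 2 * R / δ * (C * ℓ) ∧
      ∀ w ∈ tangentTo (n := n) P (γ 0, γ 1),
        localRep g x₀ (extChartAt (𝓡 n) x₀ (γ 0)) u.1 (chartDeriv n x₀ (γ 0) w.1) -
          localRep g x₀ (extChartAt (𝓡 n) x₀ (γ 1)) u.2 (chartDeriv n x₀ (γ 1) w.2) = 0 := by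
  have h0 : (0 : ℝ) ∈ Icc (0 : ℝ) 1 := ⟨le_rfl, zero_le_one⟩
  have h1 : (1 : ℝ) ∈ Icc (0 : ℝ) 1 := ⟨zero_le_one, le_rfl⟩
  have hR : 0 ≤ R := (norm_nonneg _).trans (hg _ (hK 0 h0)).1
  obtain ⟨m, hm, u₀, u₁, hu₀, hu₁, hle, hge, hsub⟩ :=
    GeneralBoundary.exists_normalized_velocities
      (contDiffOn_extChartAt_comp (m := 2) hγ.1.1 hs) (C := 3 / 2 * R / δ) (by positivity)
      (fun t ht ↦ hγ.1.norm_acceleration_le hδ hg ht (hs t ht) (hK t ht))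
      (integral_norm_derivWithin_le hγ.1.1 hs hC hℓ₀ hℓ)
      (by
        obtain ⟨t, ht, hne⟩ := hne
        exact ⟨t, ht, fun h ↦ hne ((extChartAt (𝓡 n) x₀).injOn (hs t ht) (hs 0 h0) h)⟩)
  exact ⟨(u₀, u₁), hle, hge, hsub, fun w hw ↦
    hγ.localRep_sub_eq_zero (hs 0 h0) (hs 1 h1) hm.ne' hu₀ hu₁ hw⟩

end Normalization

/-! ### Limits of shrinking geodesics -/

section Limits

variable {n : ℕ} {M : Type*}

theorem chartDeriv_surjective [TopologicalSpace M] [ChartedSpace (E n) M] [IsManifold (𝓡 n) ∞ M]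
    {x₀ q : M} (hq : q ∈ (extChartAt (𝓡 n) x₀).source) :
    Function.Surjective (chartDeriv n x₀ q) := by
  have : IsManifold (𝓡 n) 1 M := .of_le (n := ∞) (by norm_cast)
  exact (isInvertible_mfderiv_extChartAt (I := 𝓡 n) hq).bijective.surjective

theorem IsMetric.eq_zero_of_localRep_eq_zero [TopologicalSpace M] [ChartedSpace (E n) M]
    [IsManifold (𝓡 n) ∞ M] {ν : ℕ} {g : BilinField n M} (hg : IsMetric ν g) (p : M) {v : E n}
    (hv : localRep g p (extChartAt (𝓡 n) p p) v = 0) : v = 0 := by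
  have hp := mem_extChartAt_source (I := 𝓡 n) p
  obtain ⟨v, rfl⟩ := chartDeriv_surjective hp v
  have : v = 0 := (hg p).1 v fun w ↦ by
    rw [← localRep_chartDeriv g hp, hv]
    rfl
  rw [this, map_zero]

/-- If `(B, -B)` vanishes on the tangent space of `P` at `(p, p)`, then `B = 0`, as `(B, -B)` also
vanishes on the diagonal. -/
theorem TransverseToDiagonal.eq_zero [TopologicalSpace M] [ChartedSpace (E n) M]
    [IsManifold (𝓡 n) ∞ M] {P : Set (M × M)} (hT : TransverseToDiagonal n P) {p : M}
    (hp : (p, p) ∈ P) {B : E n →L[ℝ] ℝ}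
    (hB : ∀ w ∈ tangentTo (n := n) P (p, p),
      B (chartDeriv n p p w.1) - B (chartDeriv n p p w.2) = 0) : B = 0 := by
  ext a
  obtain ⟨a, rfl⟩ := chartDeriv_surjective (mem_extChartAt_source (I := 𝓡 n) p) a
  have ha : ((a, 0) : TProd n (p, p)) ∈ tangentTo (n := n) P (p, p) ⊔ tangentDiag n p := by
    rw [hT p hp]
    trivial
  obtain ⟨w, hw, _, ⟨e, rfl⟩, hwe⟩ := Submodule.mem_sup.1 ha
  have h1 : w.1 + e = a := congrArg Prod.fst hwe
  have h2 : w.2 + e = 0 := congrArg Prod.snd hwe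
  have h3 := hB w hw
  have h4 : B (chartDeriv n p p w.2) + B (chartDeriv n p p e) = 0 := by
    rw [← map_add, ← map_add, h2, map_zero, map_zero]
  rw [← h1, map_add, map_add]
  change _ = (0 : ℝ)
  linarith

/-- Evaluation of bilinear forms is jointly continuous. -/
theorem tendsto_bilin_apply {n : ℕ} {ι : Type*} {l : Filter ι} {B : ι → E n →L[ℝ] E n →L[ℝ] ℝ}
    {B₀ : E n →L[ℝ] E n →L[ℝ] ℝ} {v w : ι → E n} {v₀ w₀ : E n} (hB : Tendsto B l (𝓝 B₀))
    (hv : Tendsto v l (𝓝 v₀)) (hw : Tendsto w l (𝓝 w₀)) :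
    Tendsto (fun i ↦ B i (v i) (w i)) l (𝓝 (B₀ v₀ w₀)) := by
  have h : Continuous fun x : (E n →L[ℝ] E n →L[ℝ] ℝ) × E n × E n ↦ x.1 x.2.1 x.2.2 := by
    fun_prop
  exact (h.tendsto (B₀, v₀, w₀)).comp (hB.prodMk_nhds (hv.prodMk_nhds hw))

theorem WhitneyTendsto.tendsto_localRep [TopologicalSpace M] [ChartedSpace (E n) M]
    {k : ℕ} {u : ℕ → BilinField n M}
    {b : BilinField n M} (h : WhitneyTendsto k u b) {x₀ : M} {K : Set (E n)} (hK : IsCompact K)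
    (hKt : K ⊆ (extChartAt (𝓡 n) x₀).target) {F : Filter ℕ} (hF : F ≤ atTop) {z : ℕ → E n}
    {y : E n} (hy : K ∈ 𝓝 y) (hz : Tendsto z F (𝓝 y)) (hb : ContinuousAt (localRep b x₀) y) :
    Tendsto (fun i ↦ localRep (u i) x₀ (z i)) F (𝓝 (localRep b x₀ y)) := by
  rw [Metric.tendsto_nhds]
  intro ε hε
  filter_upwards [hF (h.eventually_norm_localRep_sub_lt hK hKt (half_pos hε)), hz hy,
    Metric.tendsto_nhds.1 (hb.tendsto.comp hz) (ε / 2) (half_pos hε)] with i h1 h2 h3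
  have h4 := dist_triangle (localRep (u i) x₀ (z i)) (localRep b x₀ (z i)) (localRep b x₀ y)
  have h5 : dist (localRep (u i) x₀ (z i)) (localRep b x₀ (z i)) < ε / 2 := by
    rw [dist_eq_norm]
    exact h1 (z i) h2
  have h6 : dist (localRep b x₀ (z i)) (localRep b x₀ y) < ε / 2 := h3
  linarith

/-- The points of a curve are no farther from its origin than its length. -/
theorem edist_le_pathELength [EMetricSpace M] [ChartedSpace (E n) M]
    [Bundle.RiemannianBundle (fun x : M ↦ TangentSpace (𝓡 n) x)] [IsRiemannianManifold (𝓡 n) M]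
    {γ : ℝ → M} {m : ℕ} (hm : m ≠ 0) (hγ : ContMDiffOn 𝓘(ℝ, ℝ) (𝓡 n) m γ (Icc 0 1)) {t : ℝ}
    (ht : t ∈ Icc (0 : ℝ) 1) : edist (γ 0) (γ t) ≤ Manifold.pathELength (𝓡 n) γ 0 1 := by
  rw [IsRiemannianManifold.out (I := 𝓡 n) (γ 0) (γ t)]
  exact (Manifold.riemannianEDist_le_pathELength
    ((hγ.mono (Icc_subset_Icc_right ht.2)).of_le (by exact_mod_cast Nat.one_le_iff_ne_zero.2 hm))
    rfl rfl ht.1).trans (Manifold.pathELength_mono le_rfl ht.2)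

theorem eventually_forall_mem_of_edist_le {M ι : Type*} [PseudoEMetricSpace M] {F : Filter ι}
    {γ : ι → ℝ → M} {s : Set ℝ} {p : M} (h0 : Tendsto (fun i ↦ γ i 0) F (𝓝 p)) {ℓ : ι → ENNReal}
    (hℓ : Tendsto ℓ F (𝓝 0)) (h : ∀ i, ∀ t ∈ s, edist (γ i 0) (γ i t) ≤ ℓ i) {A : Set M}
    (hA : A ∈ 𝓝 p) : ∀ᶠ i in F, ∀ t ∈ s, γ i t ∈ A := by
  obtain ⟨ε, hε, hεA⟩ := EMetric.mem_nhds_iff.1 hA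
  have hε2 : 0 < ε / 2 := ENNReal.half_pos hε.ne'
  filter_upwards [EMetric.tendsto_nhds.1 h0 (ε / 2) hε2, hℓ.eventually_lt_const hε2]
    with i h1 h2 t ht
  refine hεA ?_
  calc edist (γ i t) p ≤ edist (γ i t) (γ i 0) + edist (γ i 0) p := edist_triangle _ _ _
    _ < ε / 2 + ε / 2 := by
      refine ENNReal.add_lt_add ?_ h1
      rw [edist_comm]
      exact (h i t ht).trans_lt h2
    _ = ε := ENNReal.add_halves ε

end Limits

end GeneralBoundary

/-- Let `M` be a smooth `n`-manifold with a complete smooth Riemannian metric, let `k ≥ 2`, let `𝓔`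
be a `C^k`-Whitney type Banach space of tensor fields over `M` and `A` an open set of metrics of
index `ν` in `𝓔`.  A general boundary condition transverse to the diagonal is admissible. -/
theorem proposition4p3 {n : ℕ} {M : Type*} [EMetricSpace M] [ChartedSpace (GeneralBoundary.E n) M]
    [IsManifold (𝓡 n) ∞ M]
    [Bundle.RiemannianBundle (fun x : M ↦ TangentSpace (𝓡 n) x)]
    [IsContMDiffRiemannianBundle (𝓡 n) ∞ (GeneralBoundary.E n)
      (fun x : M ↦ TangentSpace (𝓡 n) x)]
    [IsRiemannianManifold (𝓡 n) M] [CompleteSpace M]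
    {k : ℕ} (hk : 2 ≤ k) {ν : ℕ} (hν : ν ≤ n)
    {V : Type*} [NormedAddCommGroup V] [NormedSpace ℝ V] [CompleteSpace V]
    (𝓔 : GeneralBoundary.WhitneyBanach n M k V) (A : Set V)
    (hA : GeneralBoundary.IsOpenInMetrics 𝓔 ν A) (P : Set (M × M))
    (hP : GeneralBoundary.IsGeneralBoundaryCondition 𝓔 A P)
    (hT : GeneralBoundary.TransverseToDiagonal n P) :
    GeneralBoundary.IsAdmissible 𝓔 A P := by

  intro g₀
  by_contra hcon
  have hneg : ∀ i : ℕ, ∃ g : GeneralBoundary.nondegenerateMetrics 𝓔 A P,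
      g ∈ Metric.ball g₀ (1 / ((i : ℝ) + 1)) ∧ ∃ γ : ℝ → M,
      GeneralBoundary.IsBoundaryGeodesic (𝓔.toField g).1 P γ ∧
      (∃ t ∈ Icc (0 : ℝ) 1, γ t ≠ γ 0) ∧
      Manifold.pathELength (𝓡 n) γ 0 1 < ENNReal.ofReal (1 / ((i : ℝ) + 1)) := by
    intro i
    by_contra hi
    push Not at hi
    exact hcon ⟨Metric.ball g₀ (1 / ((i : ℝ) + 1)), Metric.isOpen_ball,
      Metric.mem_ball_self Nat.one_div_pos_of_nat, 1 / ((i : ℝ) + 1), Nat.one_div_pos_of_nat,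
      fun g hg γ hγ hne ↦ hi g hg γ hγ hne⟩
  choose g hgball γ hγ hne hlen using hneg
  have hlim : Tendsto (fun i : ℕ ↦ 1 / ((i : ℝ) + 1)) atTop (𝓝 0) :=
    tendsto_one_div_add_atTop_nhds_zero_nat
  have hg : Tendsto (fun i ↦ (g i : V)) atTop (𝓝 (g₀ : V)) := by
    have : Tendsto g atTop (𝓝 g₀) := tendsto_iff_dist_tendsto_zero.2
      (squeeze_zero (fun _ ↦ dist_nonneg) (fun i ↦ (hgball i).le) hlim)
    exact (continuous_subtype_val.tendsto g₀).comp this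
  have hW := 𝓔.whitneyTendsto _ _ hg
  -- Limits are taken along a fixed ultrafilter, which spares all passages to subsequences.
  let F : Ultrafilter ℕ := hyperfilter ℕ
  have hF : (F : Filter ℕ) ≤ atTop := Nat.hyperfilter_le_atTop
  have hℓ : Tendsto (fun i : ℕ ↦ ENNReal.ofReal (1 / ((i : ℝ) + 1))) F (𝓝 0) := by
    have := (ENNReal.continuous_ofReal.tendsto 0).comp (hlim.mono_left hF)
    rwa [ENNReal.ofReal_zero] at this
  have hedist : ∀ i, ∀ t ∈ Icc (0 : ℝ) 1,
      edist (γ i 0) (γ i t) ≤ ENNReal.ofReal (1 / ((i : ℝ) + 1)) := fun i t ht ↦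
    (GeneralBoundary.edist_le_pathELength two_ne_zero (hγ i).1.1 ht).trans (hlen i).le
  obtain ⟨⟨p, q⟩, hpq, hFpq⟩ := hP.isCompact.ultrafilter_le_nhds
    (F.map fun i ↦ (γ i 0, γ i 1)) (le_principal_iff.2
      (Eventually.of_forall (f := (F : Filter ℕ)) fun i ↦ (hγ i).2.1))
  have hx : Tendsto (fun i ↦ (γ i 0, γ i 1)) F (𝓝 (p, q)) := hFpq
  have h0 : Tendsto (fun i ↦ γ i 0) F (𝓝 p) := (continuous_fst.tendsto (p, q)).comp hx
  have h1 : Tendsto (fun i ↦ γ i 1) F (𝓝 q) := (continuous_snd.tendsto (p, q)).comp hx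
  obtain rfl : p = q := by
    rw [← edist_le_zero]
    exact le_of_tendsto_of_tendsto' (h0.edist h1) hℓ fun i ↦ hedist i 1 ⟨zero_le_one, le_rfl⟩
  have hxP : Tendsto (fun i ↦ (γ i 0, γ i 1)) F (𝓝[P] (p, p)) :=
    tendsto_nhdsWithin_iff.2 ⟨hx, Eventually.of_forall fun i ↦ (hγ i).2.1⟩
  have hmetric : GeneralBoundary.IsMetric ν (𝓔.toField g₀).1 := by
    obtain ⟨U, -, rfl⟩ := hA
    exact g₀.2.1.2
  have hp := mem_extChartAt_source (I := 𝓡 n) p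
  set y₀ := extChartAt (𝓡 n) p p with hy₀
  have hB₀ : ContinuousAt (GeneralBoundary.localRep (𝓔.toField g₀).1 p) y₀ :=
    (GeneralBoundary.contDiffAt_localRep (𝓔.toField g₀).2.1 p).continuousAt
  obtain ⟨K, hK, δ, hδ, R, hKt, hKc, hbounds⟩ :=
    hW.exists_uniform_bounds (one_le_two.trans hk) (𝓔.toField g₀).2.1 p
      fun v hv ↦ hmetric.eq_zero_of_localRep_eq_zero p hv
  obtain ⟨C, hC⟩ := GeneralBoundary.exists_enorm_chartDeriv_le (n := n) p
  have hloc := GeneralBoundary.eventually_forall_mem_of_edist_le h0 hℓ hedist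
    (inter_mem (inter_mem (extChartAt_source_mem_nhds (I := 𝓡 n) p)
      ((continuousAt_extChartAt (I := 𝓡 n) p).preimage_mem_nhds hK)) hC)
  have hvel : ∀ᶠ i : ℕ in (F : Filter ℕ), ∃ u : GeneralBoundary.E n × GeneralBoundary.E n,
      ‖u.1‖ ≤ 1 ∧ 1 - 3 / 2 * R / δ * (C * (1 / ((i : ℝ) + 1))) ≤ ‖u.1‖ ∧
      ‖u.2 - u.1‖ ≤ 3 / 2 * R / δ * (C * (1 / ((i : ℝ) + 1))) ∧
      ∀ w ∈ GeneralBoundary.tangentTo (n := n) P (γ i 0, γ i 1),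
        GeneralBoundary.localRep (𝓔.toField (g i)).1 p (extChartAt (𝓡 n) p (γ i 0)) u.1
            (GeneralBoundary.chartDeriv n p (γ i 0) w.1) -
          GeneralBoundary.localRep (𝓔.toField (g i)).1 p (extChartAt (𝓡 n) p (γ i 1)) u.2
            (GeneralBoundary.chartDeriv n p (γ i 1) w.2) = 0 := by
    filter_upwards [hloc, hF hbounds] with i hi hbi
    exact (hγ i).exists_normalized_velocities (hne i) hδ hbi (fun t ht ↦ (hi t ht).1.1)
      (fun t ht ↦ (hi t ht).1.2) (fun t ht ↦ (hi t ht).2) Nat.one_div_pos_of_nat.le (hlen i).le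
  obtain ⟨u, hu⟩ := skolem.1 hvel
  have herr : Tendsto (fun i : ℕ ↦ 3 / 2 * R / δ * (C * (1 / ((i : ℝ) + 1)))) F (𝓝 0) := by
    simpa using ((hlim.mono_left hF).const_mul (C : ℝ)).const_mul (3 / 2 * R / δ)
  obtain ⟨v, -, hFv⟩ := (isCompact_closedBall (0 : GeneralBoundary.E n) 1).ultrafilter_le_nhds
    (F.map fun i ↦ (u i).1) (le_principal_iff.2 (hu.mono fun i hi ↦ by simpa using hi.1))
  have hu₀ : Tendsto (fun i ↦ (u i).1) F (𝓝 v) := hFv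
  have hu₁ : Tendsto (fun i ↦ (u i).2) F (𝓝 v) := by
    have : Tendsto (fun i ↦ (u i).2 - (u i).1) F (𝓝 0) :=
      squeeze_zero_norm' (hu.mono fun i hi ↦ hi.2.2.1) herr
    simpa using this.add hu₀
  have hv : 1 ≤ ‖v‖ := by
    refine le_of_tendsto_of_tendsto ?_ hu₀.norm (hu.mono fun i hi ↦ hi.2.1)
    simpa using herr.const_sub 1
  have hz : ∀ {x : ℕ → M}, Tendsto x F (𝓝 p) →
      Tendsto (fun i ↦ GeneralBoundary.localRep (𝓔.toField (g i)).1 p (extChartAt (𝓡 n) p (x i)))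
        F (𝓝 (GeneralBoundary.localRep (𝓔.toField g₀).1 p y₀)) := fun hx ↦
    hW.tendsto_localRep hKc hKt hF hK ((continuousAt_extChartAt (I := 𝓡 n) p).tendsto.comp hx) hB₀
  have hzero : GeneralBoundary.localRep (𝓔.toField g₀).1 p y₀ v = 0 := by
    refine hT.eq_zero hpq fun w hw ↦ ?_
    obtain ⟨f, hf, hf1, hf2⟩ :=
      GeneralBoundary.exists_tangentTo_tendsto hP.isSubmanifold hpq hp hp hw
    have hlim := ((GeneralBoundary.tendsto_bilin_apply (hz h0) hu₀ (hf1.comp hxP)).sub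
      (GeneralBoundary.tendsto_bilin_apply (hz h1) hu₁ (hf2.comp hxP)))
    refine tendsto_nhds_unique (hlim.congr' ?_) tendsto_const_nhds
    filter_upwards [hu, hxP.eventually hf] with i hi hfi
    exact hi.2.2.2 _ hfi
  have : v = 0 := hmetric.eq_zero_of_localRep_eq_zero p hzero
  rw [this, norm_zero] at hv
  exact absurd hv (by norm_num)
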